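/- **Setting.** Fix types of states $S$, programs, event names, event-system identifiers $\mathcal K$ and security domains $\mathcal D$, a static configuration $\Sigma$, and an arbitrary small-step semantics of programs $\Sigma\vdash(P,s)\to(Q,t)$, where $Q$ is a program or $\bot$ (terminated). *Syntax.* An event is a basic event $(l,g,P)$ (name, guard $g\subseteq S$, body $P$) or a triggered event $\lfloor P\rfloor$ or $\lfloor\bot\rfloor$. An event system is a set of events, or a sequence $\mathcal E;\mathcal S$ of an event and an event system. A parallel event system $\mathcal{PS}$ assigns to each $\kappa\in\mathcal K$ an event system; $evts(\mathcal{PS})$ is the set of all events occurring in it. *Semantics.* Configurations are triples $(\sharp,s,x)$ of a specification, a state and an event context $x$, which assigns an event to each $\kappa$. Action transitions carry a label $c@\kappa$ (program action) or $ev@\kappa$ (occurrence of $ev$). For events: if $s\in g$ and $ev=(l,g,P)$, then $(ev,s,x)\to^{ev@\kappa}(\lfloor P\rfloor,s,x[\kappa\mapsto ev])$; if $(P,s)\to(Q,t)$, then $(\lfloor P\rfloor,s,x)\to^{c@\kappa}(\lfloor Q\rfloor,t,x)$. An event set $U$ makes a step $ev@\kappa$ of some $ev\in U$ to a sequence $\mathcal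 E';U$; a sequence $\mathcal E;\mathcal S$ makes the steps of $\mathcal E$ and becomes $\mathcal S$ when $\mathcal E$ reaches $\lfloor\bot\rfloor$; a parallel event system interleaves the steps of its components, a step of $\mathcal{PS}(\kappa)$ being labelled with $\kappa$. *Rely-guarantee.* A specification is a quadruple $\langle pre,R,G,pst\rangle$ with $pre,pst\subseteq S$ and $R,G\subseteq S\times S$. An event $ev$ is valid for it, $\Sigma\models ev\ \mathbf{sat}\ \langle pre,R,G,pst\rangle$, if in every finite sequence of action and environment transitions from $ev$ in a state of $pre$ (environment transitions keep the specification $\sharp$ and may change state and context) all of whose environment transitions change the state according to $R$, all action transitions change the state according to $G$, and the last state is in $pst$ if $\lfloor\bot\rfloor$ has been reached. Let $\Gamma$ assign to each event $ev$ a specification $\Gamma(ev)=\langle pre_{ev},R_{ev},G_{ev},pst_{ev}\rangle$. For event systems and parallel event systems, $\Sigma\vdash\cdot\ \mathbf{sat}\ \langle pre,R,G,pst\rangle$ means derivability, with every event used at its specification $\Gamma(ev)$, by the following rules. - Event set $U$: for all $ev,ev'\in U$, $\Sigma\models ev\ \mathbf{sat}\ \Gamma(ev)$, $pre\subseteq pre_{ev}$,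 $R\subseteq R_{ev}$, $G_{ev}\subseteq G$, $pst_{ev}\subseteq pst$ and $pst_{ev}\subseteq pre_{ev'}$. - Event sequence $ev;\mathcal S$: $\Sigma\models ev\ \mathbf{sat}\ \Gamma(ev)$, and $\Sigma\vdash\mathcal S\ \mathbf{sat}\ \langle pre',R',G',pst'\rangle$ for some $pre',R',G',pst'$ with $pre\subseteq pre_{ev}$, $pst_{ev}\subseteq pre'$, $pst'\subseteq pst$, $R\subseteq R_{ev}\cap R'$, $G_{ev}\cup G'\subseteq G$. - Consequence, for event systems: $pre$ and $R$ may be shrunk, $G$ and $pst$ enlarged. - Parallel composition: for some specifications $\langle pres_\kappa,Rs_\kappa,Gs_\kappa,psts_\kappa\rangle$ and all $\kappa$, $\Sigma\vdash\mathcal{PS}(\kappa)\ \mathbf{sat}\ \langle pres_\kappa,Rs_\kappa,Gs_\kappa,psts_\kappa\rangle$, $pre\subseteq pres_\kappa$, $psts_\kappa\subseteq pst$, $Gs_\kappa\subseteq G$, $R\subseteq Rs_\kappa$, and $Gs_\kappa\subseteq Rs_{\kappa'}$ for all $\kappa'\ne\kappa$. *Security.* Let $\leadsto$ be a reflexive relation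 on $\mathcal D$, let $\sim_d$ be an equivalence relation on $S$ for every $d\in\mathcal D$, and let $dom\_e(s,\kappa,ev)\in\mathcal D$ be the execution domain of $ev$ in $\kappa$ at state $s$. The state machine of the closed system $\mathcal{PS}$ (no environment transitions) has the configurations as states, initial state $\mathcal C_0=(\mathcal{PS},s_0,x_0)$, and actions $a=\langle\delta,ev,d_a\rangle$; $(\mathcal C,\mathcal C')\in step(a)$ means that $\mathcal C\to^{\delta}\mathcal C'$ and that, for some $\kappa$, either $\delta=ev@\kappa$, or $\delta=c@\kappa$ and $ev=x_{\mathcal C}(\kappa)$, and in both cases $dom\_e(s_{\mathcal C},\kappa,ev)=d_a$. **Theorem (Compositionality of Integrity).** Let $\mathcal{PS}$ be a parallel event system, $s_0\in S$, $x_0$ an event context, and suppose that 1. all events in $evts(\mathcal{PS})$ are basic; 2. $\Sigma\models ev\ \mathbf{sat}\ \Gamma(ev)$ for all $ev\in evts(\mathcal{PS})$; 3. $\Sigma\vdash\mathcal{PS}\ \mathbf{sat}\ \langle\{s_0\},\emptyset,S\times S,S\rangle$; 4. for all $ev\in evts(\mathcal{PS})$, $\kappa\in\mathcal K$, $d\in\mathcal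 D$ and $(s,s')\in G_{ev}$, if $dom\_e(s,\kappa,ev)\not\leadsto d$ then $s\sim_d s'$. Then $\mathcal{PS}$ satisfies integrity: for every configuration $\mathcal C$ reachable from $\mathcal C_0$ in the state machine, every action $a$, every $d\in\mathcal D$ with $d_a\not\leadsto d$, and every $\mathcal C'$ with $(\mathcal C,\mathcal C')\in step(a)$, the states satisfy $s_{\mathcal C}\sim_d s_{\mathcal C'}$. -/

import Mathlib

namespace PiCore

/-! ## Abstract syntax -/

/-- The language in which event bodies are written is a parameter of the framework: an arbitrary
small-step semantics.  `step σ P s Q t` says that under the static configuration `σ` the program `P`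
in state `s` makes one step to `Q` and state `t`; the continuation `none` means that the program has
terminated, so a terminated program makes no step.  No law is imposed on `step`. -/
structure ProgLang (Cfg S Prog : Type*) where
  step : Cfg → Prog → S → Option Prog → S → Prop

/-- Events: a basic event (name, guard, body), pending to be triggered, or a triggered event, whose
body is being executed (`triggered none` is an event whose body has terminated). -/
inductive Event (L S Prog : Type*) where
  | basic (name : L) (guard : Set S) (body : Prog)
  | triggered (P : Option Prog)

/-- `ev` is a basic event. -/
def Event.IsBasic {L S Prog : Type*} : Event L S Prog → Prop
  | .basic _ _ _ => True
  | .triggered _ => False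

/-- Event systems: a set of events, or an event followed by an event system. -/
inductive ESys (L S Prog : Type*) where
  | evtSet (evs : Set (Event L S Prog))
  | evtSeq (e : Event L S Prog) (es : ESys L S Prog)

/-- Parallel event systems: one event system for each identifier `κ : K`. -/
abbrev PESys (L S Prog K : Type*) := K → ESys L S Prog

/-- The events occurring in an event system. -/
def ESys.evts {L S Prog : Type*} : ESys L S Prog → Set (Event L S Prog)
  | .evtSet evs => evs
  | .evtSeq e es => insert e es.evts

/-- The events occurring in a parallel event system. -/
def PESys.evts {L S Prog K : Type*} (PS : PESys L S Prog K) : Set (Event L S Prog) :=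
  {ev | ∃ κ, ev ∈ (PS κ).evts}

/-! ## Operational semantics -/

/-- A configuration `(♯, s, x)`: a specification, a state, and an event context, which records for
every event system the event that it is executing. -/
@[ext] structure Conf (Spec L S Prog K : Type*) where
  spec : Spec
  state : S
  ctx : K → Event L S Prog

/-- What happens in a transition: an action `c` of a program, or the occurrence of an event. -/
inductive Act (L S Prog : Type*) where
  | cmd
  | occ (ev : Event L S Prog)

/-- A transition label `t@κ`. -/
structure Label (L S Prog K : Type*) where
  act : Act L S Prog
  sys : K

section Semantics

variable {Cfg L S Prog K : Type*} [DecidableEq K]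

/-- Action transitions of events. -/
inductive EvTran (lang : ProgLang Cfg S Prog) (σ : Cfg) :
    Conf (Event L S Prog) L S Prog K → Label L S Prog K →
      Conf (Event L S Prog) L S Prog K → Prop
  /-- A basic event whose guard holds is triggered; the event context records it. -/
  | entry {l : L} {g : Set S} {P : Prog} {s : S} {x : K → Event L S Prog} {κ : K} (hs : s ∈ g) :
      EvTran lang σ ⟨.basic l g P, s, x⟩ ⟨.occ (.basic l g P), κ⟩
        ⟨.triggered (some P), s, Function.update x κ (.basic l g P)⟩
  /-- A triggered event simulates its program. -/
  | prog {P : Prog} {Q : Option Prog} {s t : S} {x : K → Event L S Prog} {κ : K}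
      (h : lang.step σ P s Q t) :
      EvTran lang σ ⟨.triggered (some P), s, x⟩ ⟨.cmd, κ⟩ ⟨.triggered Q, t, x⟩

/-- Action transitions of event systems. -/
inductive ESTran (lang : ProgLang Cfg S Prog) (σ : Cfg) :
    Conf (ESys L S Prog) L S Prog K → Label L S Prog K →
      Conf (ESys L S Prog) L S Prog K → Prop
  /-- One event of an event set occurs; when it has finished, the event set resumes. -/
  | occur {evs : Set (Event L S Prog)} {ev e' : Event L S Prog} {s s' : S}
      {x x' : K → Event L S Prog} {κ : K} (hev : ev ∈ evs)
      (h : EvTran lang σ ⟨ev, s, x⟩ ⟨.occ ev, κ⟩ ⟨e', s', x'⟩) :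
      ESTran lang σ ⟨.evtSet evs, s, x⟩ ⟨.occ ev, κ⟩ ⟨.evtSeq e' (.evtSet evs), s', x'⟩
  /-- The first event of a sequence makes a step and is not finished. -/
  | seq {e e' : Event L S Prog} {es : ESys L S Prog} {s s' : S} {x x' : K → Event L S Prog}
      {δ : Label L S Prog K} (h : EvTran lang σ ⟨e, s, x⟩ δ ⟨e', s', x'⟩)
      (hne : e' ≠ .triggered none) :
      ESTran lang σ ⟨.evtSeq e es, s, x⟩ δ ⟨.evtSeq e' es, s', x'⟩
  /-- The first event of a sequence makes its last step. -/
  | seqDone {e : Event L S Prog} {es : ESys L S Prog} {s s' : S} {x x' : K → Event L S Prog}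
      {δ : Label L S Prog K} (h : EvTran lang σ ⟨e, s, x⟩ δ ⟨.triggered none, s', x'⟩) :
      ESTran lang σ ⟨.evtSeq e es, s, x⟩ δ ⟨es, s', x'⟩

/-- Action transitions of parallel event systems: interleaving of the event systems. -/
inductive PESTran (lang : ProgLang Cfg S Prog) (σ : Cfg) :
    Conf (PESys L S Prog K) L S Prog K → Label L S Prog K →
      Conf (PESys L S Prog K) L S Prog K → Prop
  | par {PS : PESys L S Prog K} {es' : ESys L S Prog} {s s' : S} {x x' : K → Event L S Prog}
      {t : Act L S Prog} {κ : K} (h : ESTran lang σ ⟨PS κ, s, x⟩ ⟨t, κ⟩ ⟨es', s', x'⟩) :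
      PESTran lang σ ⟨PS, s, x⟩ ⟨t, κ⟩ ⟨Function.update PS κ es', s', x'⟩

/-! ## Rely-guarantee specifications -/

/-- A rely-guarantee specification `⟨pre, R, G, pst⟩`. -/
structure RGCond (S : Type*) where
  pre : Set S
  rely : Set (S × S)
  guar : Set (S × S)
  post : Set S

/-- The two kinds of transitions in a computation. -/
inductive Kind where
  | env
  | action

/-- `EvComp lang σ C ϖ`: the transitions in the list `ϖ`, each given by its kind and its target,
form a computation of an event from the configuration `C`.  An environment transition keeps the
specification; an action transition is one of the operational semantics. -/
def EvComp (lang : ProgLang Cfg S Prog) (σ : Cfg) :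
    Conf (Event L S Prog) L S Prog K → List (Kind × Conf (Event L S Prog) L S Prog K) → Prop
  | _, [] => True
  | C, (.env, C') :: ϖ => C'.spec = C.spec ∧ EvComp lang σ C' ϖ
  | C, (.action, C') :: ϖ => (∃ δ, EvTran lang σ C δ C') ∧ EvComp lang σ C' ϖ

/-- All transitions of kind `k` in the computation `ϖ` from `C` change the state as `R` allows. -/
def StepsIn {Spec : Type*} (k : Kind) (R : Set (S × S)) :
    Conf Spec L S Prog K → List (Kind × Conf Spec L S Prog K) → Prop
  | _, [] => True
  | C, (k', C') :: ϖ => (k' = k → (C.state, C'.state) ∈ R) ∧ StepsIn k R C' ϖ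

/-- The last configuration of the computation `ϖ` from `C`. -/
def lastConf {Spec : Type*} :
    Conf Spec L S Prog K → List (Kind × Conf Spec L S Prog K) → Conf Spec L S Prog K
  | C, [] => C
  | _, (_, C') :: ϖ => lastConf C' ϖ

variable (K) in
/-- Validity of a rely-guarantee specification of an event: in every computation from a state in
`pre` in which all environment transitions are in the rely relation, all action transitions are in
the guarantee relation, and if the event has finished at the end then the last state is in `post`. -/
def EvSat (lang : ProgLang Cfg S Prog) (σ : Cfg) (ev : Event L S Prog) (c : RGCond S) : Prop :=
  ∀ (s : S) (x : K → Event L S Prog) (ϖ : List (Kind × Conf (Event L S Prog) L S Prog K)),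
    s ∈ c.pre → EvComp lang σ ⟨ev, s, x⟩ ϖ → StepsIn .env c.rely ⟨ev, s, x⟩ ϖ →
      StepsIn .action c.guar ⟨ev, s, x⟩ ϖ ∧
        ((lastConf ⟨ev, s, x⟩ ϖ).spec = .triggered none → (lastConf ⟨ev, s, x⟩ ϖ).state ∈ c.post)

variable (K) in
/-- The rely-guarantee proof rules for event systems, where every event `ev` is used with its
specification `Γ ev`. -/
inductive ESysSat (lang : ProgLang Cfg S Prog) (σ : Cfg) (Γ : Event L S Prog → RGCond S) :
    ESys L S Prog → RGCond S → Prop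
  | evtSet {evs : Set (Event L S Prog)} {c : RGCond S}
      (hsat : ∀ ev ∈ evs, EvSat K lang σ ev (Γ ev))
      (hpre : ∀ ev ∈ evs, c.pre ⊆ (Γ ev).pre)
      (hrely : ∀ ev ∈ evs, c.rely ⊆ (Γ ev).rely)
      (hguar : ∀ ev ∈ evs, (Γ ev).guar ⊆ c.guar)
      (hpost : ∀ ev ∈ evs, (Γ ev).post ⊆ c.post)
      (hnext : ∀ ev ∈ evs, ∀ ev' ∈ evs, (Γ ev).post ⊆ (Γ ev').pre) :
      ESysSat lang σ Γ (.evtSet evs) c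
  | evtSeq {e : Event L S Prog} {es : ESys L S Prog} {c d : RGCond S}
      (hsat : EvSat K lang σ e (Γ e))
      (hes : ESysSat lang σ Γ es d)
      (hpre : c.pre ⊆ (Γ e).pre)
      (hnext : (Γ e).post ⊆ d.pre)
      (hpost : d.post ⊆ c.post)
      (hrely : c.rely ⊆ (Γ e).rely) (hrely' : c.rely ⊆ d.rely)
      (hguar : (Γ e).guar ⊆ c.guar) (hguar' : d.guar ⊆ c.guar) :
      ESysSat lang σ Γ (.evtSeq e es) c
  | conseq {es : ESys L S Prog} {c d : RGCond S}
      (hes : ESysSat lang σ Γ es d)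
      (hpre : c.pre ⊆ d.pre) (hrely : c.rely ⊆ d.rely)
      (hguar : d.guar ⊆ c.guar) (hpost : d.post ⊆ c.post) :
      ESysSat lang σ Γ es c

/-- The rely-guarantee proof rule for the parallel composition of event systems, where every event
`ev` is used with its specification `Γ ev`. -/
inductive PESysSat (lang : ProgLang Cfg S Prog) (σ : Cfg) (Γ : Event L S Prog → RGCond S) :
    PESys L S Prog K → RGCond S → Prop
  | par {PS : PESys L S Prog K} {c : RGCond S} (d : K → RGCond S)
      (hes : ∀ κ, ESysSat K lang σ Γ (PS κ) (d κ))
      (hpre : ∀ κ, c.pre ⊆ (d κ).pre)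
      (hpost : ∀ κ, (d κ).post ⊆ c.post)
      (hguar : ∀ κ, (d κ).guar ⊆ c.guar)
      (hrely : ∀ κ, c.rely ⊆ (d κ).rely)
      (hcompat : ∀ κ κ', κ ≠ κ' → (d κ).guar ⊆ (d κ').rely) :
      PESysSat lang σ Γ PS c

end Semantics

/-! ## Security configuration, state machine, integrity -/

/-- A security configuration: a reflexive interference relation on the domains `D`, for every domain
an equivalence relation on states, and the domain that executes an event, which may depend on the
state and on the event system. -/
structure SecConfig (L S Prog K D : Type*) where
  interferes : D → D → Prop
  interferes_refl : ∀ d, interferes d d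
  view : D → Setoid S
  domE : S → K → Event L S Prog → D

/-- An action `⟨δ, ev, d⟩` of the state machine. -/
structure SMAction (L S Prog K D : Type*) where
  label : Label L S Prog K
  ev : Event L S Prog
  dom : D

/-- A nondeterministic state machine with states `Δ` and actions `A`. -/
structure StateMachine (Δ A : Type*) where
  step : A → Set (Δ × Δ)
  init : Δ

/-- The executions of a sequence of actions. -/
def StateMachine.run {Δ A : Type*} (M : StateMachine Δ A) : List A → Set (Δ × Δ)
  | [] => {p | p.1 = p.2}
  | a :: as => {p | ∃ C, (p.1, C) ∈ M.step a ∧ (C, p.2) ∈ M.run as}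

/-- Reachability from the initial state of the machine. -/
def StateMachine.Reachable {Δ A : Type*} (M : StateMachine Δ A) (C : Δ) : Prop :=
  ∃ as, (M.init, C) ∈ M.run as

section Integrity

variable {Cfg L S Prog K D : Type*} [DecidableEq K]

/-- The state machine of the closed parallel event system `PS` started in state `s₀` with event
context `x₀`. -/
def stateMachine (lang : ProgLang Cfg S Prog) (σ : Cfg) (sec : SecConfig L S Prog K D)
    (PS : PESys L S Prog K) (s₀ : S) (x₀ : K → Event L S Prog) :
    StateMachine (Conf (PESys L S Prog K) L S Prog K) (SMAction L S Prog K D) where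
  step a := {p | PESTran lang σ p.1 a.label p.2 ∧
    ((∃ κ, a.label = ⟨.occ a.ev, κ⟩ ∧ sec.domE p.1.state κ a.ev = a.dom) ∨
      (∃ κ, a.label = ⟨.cmd, κ⟩ ∧ a.ev = p.1.ctx κ ∧ sec.domE p.1.state κ a.ev = a.dom))}
  init := ⟨PS, s₀, x₀⟩

/-- Integrity of a parallel event system: an action in a reachable configuration changes the state
only for domains with which the domain of the action may interfere. -/
def Integrity (lang : ProgLang Cfg S Prog) (σ : Cfg) (sec : SecConfig L S Prog K D)
    (PS : PESys L S Prog K) (s₀ : S) (x₀ : K → Event L S Prog) : Prop :=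
  ∀ (a : SMAction L S Prog K D) (d : D) (C C' : Conf (PESys L S Prog K) L S Prog K),
    (stateMachine lang σ sec PS s₀ x₀).Reachable C → ¬ sec.interferes a.dom d →
      (C, C') ∈ (stateMachine lang σ sec PS s₀ x₀).step a → (sec.view d) C.state C'.state

/-- Integrity on the events of a parallel event system with specifications `Γ`. -/
def IntegrityOnEvents (sec : SecConfig L S Prog K D) (PS : PESys L S Prog K)
    (Γ : Event L S Prog → RGCond S) : Prop :=
  ∀ (ev : Event L S Prog) (d : D) (s s' : S) (κ : K),
    ev ∈ PS.evts → (s, s') ∈ (Γ ev).guar → ¬ sec.interferes (sec.domE s κ ev) d →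
      (sec.view d) s s'

end Integrity

end PiCore

/-!
Integrity is a statement about single steps of the closed system, while the specifications of
events are statements about computations of single events, so the proof carries an invariant along
the executions of the closed system that relates the two.

The event that a component `κ` is executing (or about to execute) sees its own steps as action
transitions and the steps of all other components as environment transitions.  Validity of a
specification passes to every suffix of a computation: `EvSafe` says that all *remaining*
computations of an event whose environment respects the rely relation respect the guarantee relation
and the postcondition, and it is preserved by environment transitions in the rely relation
(`EvSafe.env`) and by action transitions (`EvSafe.action`).  In particular no stability of preconditions under the rely relation is needed,
because an environment transition that precedes the occurrence of an event is already part of the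
computation of that event.

`ESysSafe` lifts this to event systems: the current event is safe for the specification of a basic
event `ev`, it is either `ev` itself or a triggered event with `ev` recorded in the event context,
and the rest of the event system is derivable from a precondition that the postcondition of `ev`
implies.  Derivability establishes it (`ESysSafe.of_sat`), the component's own steps preserve it and
lie in its guarantee (`ESysSafe.step`), and environment steps in its rely relation preserve it
(`ESysSafe.env`).
Because the guarantee of each component is contained in the rely relation of all others, safety of
all components is an invariant (`PESTran.invariant`).

In a reachable configuration a program step of `κ` is therefore in the guarantee of the event that
the context records for `κ`, so that integrity on events applies; the occurrence of an event does
not change the state at all.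
-/

namespace PiCore

section Safety

variable {Cfg L S Prog K : Type*} [DecidableEq K] {lang : ProgLang Cfg S Prog} {σ : Cfg}

/-- Every computation of an event from the configuration `C` in which the environment respects the
rely relation of `c` respects its guarantee relation, and ends in its postcondition if the event has
finished.  The precondition of `c` plays no role: `C` may be in the middle of an execution. -/
def EvSafe (lang : ProgLang Cfg S Prog) (σ : Cfg) (c : RGCond S)
    (C : Conf (Event L S Prog) L S Prog K) : Prop :=
  ∀ ϖ, EvComp lang σ C ϖ → StepsIn .env c.rely C ϖ →
    StepsIn .action c.guar C ϖ ∧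
      ((lastConf C ϖ).spec = .triggered none → (lastConf C ϖ).state ∈ c.post)

theorem EvSat.safe {ev : Event L S Prog} {c : RGCond S} (h : EvSat K lang σ ev c) {s : S}
    (hs : s ∈ c.pre) (x : K → Event L S Prog) : EvSafe lang σ c ⟨ev, s, x⟩ :=
  fun ϖ hϖ hR => h s x ϖ hs hϖ hR

theorem EvSafe.env {c : RGCond S} {e : Event L S Prog} {s t : S} {x y : K → Event L S Prog}
    (h : EvSafe lang σ c ⟨e, s, x⟩) (hst : (s, t) ∈ c.rely) : EvSafe lang σ c ⟨e, t, y⟩ := by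
  intro ϖ hϖ hR
  have := h ((.env, ⟨e, t, y⟩) :: ϖ) ⟨rfl, hϖ⟩ ⟨fun _ => hst, hR⟩
  exact ⟨this.1.2, this.2⟩

theorem EvSafe.action {c : RGCond S} {C C' : Conf (Event L S Prog) L S Prog K}
    {δ : Label L S Prog K} (h : EvSafe lang σ c C) (ht : EvTran lang σ C δ C') :
    EvSafe lang σ c C' := by
  intro ϖ hϖ hR
  have := h ((.action, C') :: ϖ) ⟨⟨δ, ht⟩, hϖ⟩ ⟨nofun, hR⟩
  exact ⟨this.1.2, this.2⟩

theorem EvSafe.guar {c : RGCond S} {C C' : Conf (Event L S Prog) L S Prog K}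
    {δ : Label L S Prog K} (h : EvSafe lang σ c C) (ht : EvTran lang σ C δ C') :
    (C.state, C'.state) ∈ c.guar :=
  (h [(.action, C')] ⟨⟨δ, ht⟩, trivial⟩ ⟨nofun, trivial⟩).1.1 rfl

theorem EvSafe.post {c : RGCond S} {C : Conf (Event L S Prog) L S Prog K}
    (h : EvSafe lang σ c C) (hC : C.spec = .triggered none) : C.state ∈ c.post :=
  (h [] trivial trivial).2 hC

theorem EvTran.not_isBasic {C C' : Conf (Event L S Prog) L S Prog K} {δ : Label L S Prog K}
    (h : EvTran lang σ C δ C') : ¬ C'.spec.IsBasic := by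
  cases h <;> exact id

theorem EvTran.ctx_of_isBasic {C C' : Conf (Event L S Prog) L S Prog K} {δ : Label L S Prog K}
    (h : EvTran lang σ C δ C') (hC : C.spec.IsBasic) :
    C'.ctx δ.sys = C.spec ∧ δ.act = .occ C.spec := by
  cases h with
  | entry hs => exact ⟨Function.update_self .., rfl⟩
  | prog h => exact hC.elim

theorem EvTran.ctx_of_not_isBasic {C C' : Conf (Event L S Prog) L S Prog K}
    {δ : Label L S Prog K} (h : EvTran lang σ C δ C') (hC : ¬ C.spec.IsBasic) :
    C'.ctx = C.ctx := by
  cases h with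
  | entry hs => exact (hC trivial).elim
  | prog h => rfl

theorem EvTran.ctx_of_ne {C C' : Conf (Event L S Prog) L S Prog K} {δ : Label L S Prog K}
    (h : EvTran lang σ C δ C') {κ : K} (hκ : κ ≠ δ.sys) : C'.ctx κ = C.ctx κ := by
  cases h with
  | entry hs => exact Function.update_of_ne hκ ..
  | prog h => rfl

theorem EvTran.state_of_occ {C C' : Conf (Event L S Prog) L S Prog K} {δ : Label L S Prog K}
    (h : EvTran lang σ C δ C') {ev : Event L S Prog} (hδ : δ.act = .occ ev) :
    C'.state = C.state := by
  cases h with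
  | entry hs => rfl
  | prog h => cases hδ

/-- Every step of an event system is a step of one of its events. -/
theorem ESTran.exists_evTran {C C' : Conf (ESys L S Prog) L S Prog K} {δ : Label L S Prog K}
    (h : ESTran lang σ C δ C') :
    ∃ e e', EvTran lang σ ⟨e, C.state, C.ctx⟩ δ ⟨e', C'.state, C'.ctx⟩ := by
  cases h with
  | occur hev h => exact ⟨_, _, h⟩
  | seq h hne => exact ⟨_, _, h⟩
  | seqDone h => exact ⟨_, _, h⟩

/-- The configuration of component `κ`, whose events come from `A`, is safe for the rely relation
`R` and the guarantee relation `G`.  In an event set each event is safe for its own specification.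
In a sequence, the first event `e` is either an event `ev` of `A` or what is left of its execution,
in which case `ev` is the event recorded for `κ` in the context, and `e` is safe for the
specification of `ev`.  The hypothesis `hsat` is what makes the rest of the sequence, or the event
set resumed after one of its events, safe again once the postcondition of `ev` holds. -/
inductive ESysSafe (lang : ProgLang Cfg S Prog) (σ : Cfg) (Γ : Event L S Prog → RGCond S)
    (A : Set (Event L S Prog)) (κ : K) (R G : Set (S × S)) :
    Conf (ESys L S Prog) L S Prog K → Prop
  | evtSet {evs : Set (Event L S Prog)} {s : S} {x : K → Event L S Prog} (hA : evs ⊆ A)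
      (hsat : ESysSat K lang σ Γ (.evtSet evs)
        ⟨{t | ∀ ev ∈ evs, t ∈ (Γ ev).pre}, R, G, Set.univ⟩)
      (hrely : ∀ ev ∈ evs, R ⊆ (Γ ev).rely)
      (hguar : ∀ ev ∈ evs, (Γ ev).guar ⊆ G)
      (hnext : ∀ ev ∈ evs, ∀ ev' ∈ evs, (Γ ev).post ⊆ (Γ ev').pre)
      (hsafe : ∀ ev ∈ evs, EvSafe lang σ (Γ ev) ⟨ev, s, x⟩) :
      ESysSafe lang σ Γ A κ R G ⟨.evtSet evs, s, x⟩
  | evtSeq {e ev : Event L S Prog} {es : ESys L S Prog} {p : Set S} {s : S}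
      {x : K → Event L S Prog} (hev : ev ∈ A) (he : e = ev ∨ ¬ e.IsBasic ∧ x κ = ev)
      (hA : es.evts ⊆ A)
      (hsat : ESysSat K lang σ Γ es ⟨p, R, G, Set.univ⟩)
      (hrely : R ⊆ (Γ ev).rely)
      (hguar : (Γ ev).guar ⊆ G)
      (hnext : (Γ ev).post ⊆ p)
      (hsafe : EvSafe lang σ (Γ ev) ⟨e, s, x⟩) :
      ESysSafe lang σ Γ A κ R G ⟨.evtSeq e es, s, x⟩

variable {Γ : Event L S Prog → RGCond S} {A : Set (Event L S Prog)} {κ : K} {R G : Set (S × S)}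

theorem ESysSafe.of_sat {es : ESys L S Prog} {c : RGCond S} (h : ESysSat K lang σ Γ es c)
    (hA : es.evts ⊆ A) (hR : R ⊆ c.rely) (hG : c.guar ⊆ G) {s : S} (hs : s ∈ c.pre)
    (x : K → Event L S Prog) : ESysSafe lang σ Γ A κ R G ⟨es, s, x⟩ := by
  induction h with
  | evtSet hsat hpre hrely hguar hpost hnext =>
    have hrely' := fun ev hev => hR.trans (hrely ev hev)
    have hguar' := fun ev hev => (hguar ev hev).trans hG
    exact .evtSet hA
      (.evtSet hsat (fun ev hev t ht => ht ev hev) hrely' hguar'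
        (fun _ _ => Set.subset_univ _) hnext)
      hrely' hguar' hnext (fun ev hev => (hsat ev hev).safe (hpre ev hev hs) x)
  | evtSeq hsat hes hpre hnext hpost hrely hrely' hguar hguar' =>
    exact .evtSeq (hA (Set.mem_insert ..)) (.inl rfl) ((Set.subset_insert ..).trans hA)
      (.conseq hes subset_rfl (hR.trans hrely') (hguar'.trans hG) (Set.subset_univ _))
      (hR.trans hrely) (hguar.trans hG) hnext (hsat.safe (hpre hs) x)
  | conseq hes hpre hrely hguar hpost ih =>
    exact ih hA (hR.trans hrely) (hguar.trans hG) (hpre hs)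

theorem ESysSafe.env {es : ESys L S Prog} {s t : S} {x y : K → Event L S Prog}
    (h : ESysSafe lang σ Γ A κ R G ⟨es, s, x⟩) (hst : (s, t) ∈ R) (hxy : y κ = x κ) :
    ESysSafe lang σ Γ A κ R G ⟨es, t, y⟩ := by
  cases h with
  | evtSet hA hsat hrely hguar hnext hsafe =>
    exact .evtSet hA hsat hrely hguar hnext
      fun ev hev => (hsafe ev hev).env (hrely ev hev hst)
  | evtSeq hev he hA hsat hrely hguar hnext hsafe =>
    exact .evtSeq hev (hxy ▸ he) hA hsat hrely hguar hnext (hsafe.env (hrely hst))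

/-- A step of a safe component keeps it safe, it is in the guarantee of the component, and if it is
a program step then it is also in the guarantee of the event recorded in the context. -/
theorem ESysSafe.step (hbasic : ∀ ev ∈ A, ev.IsBasic) {C C' : Conf (ESys L S Prog) L S Prog K}
    {a : Act L S Prog} (h : ESysSafe lang σ Γ A κ R G C) (ht : ESTran lang σ C ⟨a, κ⟩ C') :
    ESysSafe lang σ Γ A κ R G C' ∧ (C.state, C'.state) ∈ G ∧
      (a = .cmd → C.ctx κ ∈ A ∧ (C.state, C'.state) ∈ (Γ (C.ctx κ)).guar) := by
  -- After every step of the first event of a sequence the context records its origin `ev`; before a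
  -- program step it does so already, because a basic event makes no program step.
  have origin : ∀ {e e' ev : Event L S Prog} {s s' : S} {x x' : K → Event L S Prog}, ev ∈ A →
      e = ev ∨ ¬ e.IsBasic ∧ x κ = ev → EvTran lang σ ⟨e, s, x⟩ ⟨a, κ⟩ ⟨e', s', x'⟩ →
      x' κ = ev ∧ (a = .cmd → x κ = ev) := by
    rintro e e' ev s s' x x' hev (rfl | ⟨hne, hx⟩) ht
    · obtain ⟨h₁, h₂⟩ := ht.ctx_of_isBasic (hbasic e hev)
      exact ⟨h₁, fun ha => by cases ha.symm.trans h₂⟩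
    · exact ⟨(congrFun (ht.ctx_of_not_isBasic hne) κ).trans hx, fun _ => hx⟩
  cases ht with
  | occur hmem ht =>
    cases h with
    | evtSet hA hsat hrely hguar hnext hsafe =>
      have hs := hsafe _ hmem
      exact ⟨.evtSeq (hA hmem) (.inr ⟨ht.not_isBasic, (origin (hA hmem) (.inl rfl) ht).1⟩)
        hA hsat (hrely _ hmem) (hguar _ hmem) (fun t ht ev' hev' => hnext _ hmem ev' hev' ht)
        (hs.action ht), hguar _ hmem (hs.guar ht), nofun⟩
  | seq ht hne =>
    cases h with
    | evtSeq hev he hA hsat hrely hguar hnext hsafe =>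
      obtain ⟨h₁, h₂⟩ := origin hev he ht
      refine ⟨.evtSeq hev (.inr ⟨ht.not_isBasic, h₁⟩) hA hsat hrely hguar hnext
        (hsafe.action ht), hguar (hsafe.guar ht), fun ha => ?_⟩
      obtain rfl := h₂ ha
      exact ⟨hev, hsafe.guar ht⟩
  | seqDone ht =>
    cases h with
    | evtSeq hev he hA hsat hrely hguar hnext hsafe =>
      refine ⟨.of_sat hsat hA subset_rfl subset_rfl (hnext ((hsafe.action ht).post rfl)) _,
        hguar (hsafe.guar ht), fun ha => ?_⟩
      obtain rfl := (origin hev he ht).2 ha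
      exact ⟨hev, hsafe.guar ht⟩

/-- Safety of all components, with compatible rely and guarantee relations, is an invariant of
parallel event systems. -/
theorem PESTran.invariant (hbasic : ∀ ev ∈ A, ev.IsBasic) {d : K → RGCond S}
    (hcompat : ∀ κ κ', κ ≠ κ' → (d κ).guar ⊆ (d κ').rely)
    {C C' : Conf (PESys L S Prog K) L S Prog K} {δ : Label L S Prog K}
    (ht : PESTran lang σ C δ C')
    (h : ∀ κ, ESysSafe lang σ Γ A κ (d κ).rely (d κ).guar ⟨C.spec κ, C.state, C.ctx⟩) (κ : K) :
    ESysSafe lang σ Γ A κ (d κ).rely (d κ).guar ⟨C'.spec κ, C'.state, C'.ctx⟩ := by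
  cases ht with
  | @par PS es' s s' x x' a κ₀ ht =>
    obtain ⟨h₁, h₂, -⟩ := (h κ₀).step hbasic ht
    by_cases hκ : κ = κ₀
    · subst hκ
      simpa using h₁
    · obtain ⟨e, e', he⟩ := ht.exists_evTran
      simpa [Function.update_of_ne hκ] using
        (h κ).env (hcompat κ₀ κ (Ne.symm hκ) h₂) (he.ctx_of_ne hκ)

end Safety

/-- A predicate that is preserved by every step is preserved by executions. -/
theorem StateMachine.run_invariant {Δ A : Type*} {M : StateMachine Δ A} {I : Δ → Prop}
    (hstep : ∀ a C C', (C, C') ∈ M.step a → I C → I C') :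
    ∀ (as : List A) (C C' : Δ), (C, C') ∈ M.run as → I C → I C'
  | [], C, C', h, hC => (show C = C' from h) ▸ hC
  | a :: as, C, C', ⟨C₁, h₁, h₂⟩, hC =>
    run_invariant hstep as C₁ C' h₂ (hstep a C C₁ h₁ hC)

end PiCore

theorem mainTheorem4 {Cfg L S Prog K D : Type*} [DecidableEq K]
    (lang : PiCore.ProgLang Cfg S Prog) (σ : Cfg) (sec : PiCore.SecConfig L S Prog K D)
    (PS : PiCore.PESys L S Prog K) (s₀ : S) (x₀ : K → PiCore.Event L S Prog)
    (Γ : PiCore.Event L S Prog → PiCore.RGCond S)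
    (hbasic : ∀ ev ∈ PS.evts, ev.IsBasic)
    (hevents : ∀ ev ∈ PS.evts, PiCore.EvSat K lang σ ev (Γ ev))
    (hclosed : PiCore.PESysSat lang σ Γ PS ⟨{s₀}, ∅, Set.univ, Set.univ⟩)
    (hintegrity : PiCore.IntegrityOnEvents sec PS Γ) :
    PiCore.Integrity lang σ sec PS s₀ x₀ := by
  obtain ⟨r, hes, hpre, -, -, -, hcompat⟩ := hclosed
  intro a d C C' ⟨as, hrun⟩ hnot ⟨ht, hdom⟩
  have hinit : ∀ κ, PiCore.ESysSafe lang σ Γ PS.evts κ (r κ).rely (r κ).guar ⟨PS κ, s₀, x₀⟩ :=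
    fun κ => .of_sat (hes κ) (fun _ hev => Exists.intro κ hev) subset_rfl subset_rfl
      (hpre κ rfl) x₀
  have hC := PiCore.StateMachine.run_invariant
    (M := PiCore.stateMachine lang σ sec PS s₀ x₀)
    (I := fun C => ∀ κ, PiCore.ESysSafe lang σ Γ PS.evts κ (r κ).rely (r κ).guar
      ⟨C.spec κ, C.state, C.ctx⟩)
    (fun _ _ _ hstep hI => hstep.1.invariant hbasic hcompat hI) as _ C hrun hinit
  obtain ⟨label, ev, da⟩ := a
  cases ht with
  | par ht =>
    rcases hdom with ⟨κ', hl, -⟩ | ⟨κ', hl, hev, hd⟩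
    · obtain ⟨e, e', he⟩ := ht.exists_evTran
      have hs := he.state_of_occ (congrArg PiCore.Label.act hl)
      exact hs ▸ (sec.view d).refl _
    · cases hl
      obtain ⟨hmem, hguar⟩ := ((hC _).step hbasic ht).2.2 rfl
      dsimp only at hev hd hnot hmem hguar
      subst hev hd
      exact hintegrity _ d _ _ _ hmem hguar hnot
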